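/- Let $X=\omega^\omega$, $\omega=\{0,1,2,\dots\}$, with the product topology and the compatible complete metric $\rho(x,y)=2^{-\min\{m\,:\,x(m)\ne y(m)\}}$ for $x\neq y$, and let $T\colon X\to X$, $(Tx)(n)=x(n+1)$, be the shift. Let $\mathcal M(X)$ be the space of Borel probability measures on $X$ with the weak$^*$ topology (tested on bounded continuous functions), and $\mathcal M_T(X)\subseteq\mathcal M(X)$ the set of $T$-invariant ones. For $x\in X$ and $n\ge1$ put $\mathcal E(x,n)=\frac1n\sum_{i<n}\delta_{T^i x}$, and let $V(x)\subseteq\mathcal M(X)$ be the set of all limit points of the sequence $(\mathcal E(x,n))_{n\ge1}$. For $V\subseteq\mathcal M(X)$ put $$G^V=\{x: V\subseteq V(x)\},\quad G_V=\{x: V(x)\subseteq V\},\quad G(V)=G^V\cap G_V,\quad {}^{V}G=\{x: V(x)\cap V\ne\emptyset\}.$$ A set is $\boldsymbol\Sigma^1_1$ if it is analytic and $\boldsymbol\Pi^1_1$ if its complement is analytic. For $\boldsymbol\Gamma\in\{\boldsymbol\Sigma^1_1,\boldsymbol\Pi^1_1\}$ a set $A\subseteq X$ is $\boldsymbol\Gamma$-complete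 if $A\in\boldsymbol\Gamma$ and for every zero-dimensional Polish space $Y$ and every $B\subseteq Y$ in $\boldsymbol\Gamma$ there is a continuous $f\colon Y\to X$ with $f^{-1}(A)=B$. The map $T$ has the specification property if for every $\varepsilon>0$ there is $N\in\omega$ such that for all $k\ge1$, $x_1,\dots,x_k\in X$ and $n_1,\dots,n_k\ge1$ there are $y\in X$ and gaps $s_1,\dots,s_{k-1}\in\{0,\dots,N\}$ with $\rho\bigl(T^{\sum_{i<j}(n_i+s_i)+t}(y),T^t(x_j)\bigr)<\varepsilon$ for all $1\le j\le k$ and $0\le t<n_j$. **Theorem.** $(X,T)$ is a Polish dynamical system (that is, $X$ is Polish and $T$ is continuous) with the specification property. Let $\mu=\delta_{\bar 0}$ be the Dirac measure at the zero sequence, $V=\{\mu\}$ and $U=\mathcal M_T(X)\setminus\{\mu\}$. Then $V$ is a closed, connected, nonempty subset of $\mathcal M_T(X)$, and 1. $G(V)$ is $\boldsymbol\Pi^1_1$-complete, and it is not $\boldsymbol\Sigma^1_1$; 2. $G_V$ is $\boldsymbol\Pi^1_1$-complete, and it is not $\boldsymbol\Sigma^1_1$; 3. ${}^{U}G$ is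 $\boldsymbol\Sigma^1_1$-complete, and it is not $\boldsymbol\Pi^1_1$. In particular, none of the three sets is Borel. -/

import Mathlib

open MeasureTheory Filter Topology TopologicalSpace
open scoped ENNReal

namespace NonCompactGeneric

noncomputable section

/-! ### Coanalytic sets and completeness -/

/-- A set is coanalytic (`Π¹₁`) if its complement is analytic (`Σ¹₁`). -/
def CoanalyticSet {X : Type*} [TopologicalSpace X] (A : Set X) : Prop :=
  AnalyticSet Aᶜ

/-- `B ⊆ Y` is continuously (Wadge) reducible to `A ⊆ X`. -/
def ContinuouslyReducible {Y X : Type*} [TopologicalSpace Y] [TopologicalSpace X]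
    (B : Set Y) (A : Set X) : Prop :=
  ∃ f : Y → X, Continuous f ∧ f ⁻¹' A = B

/-- `A` is `Σ¹₁`-complete: it is analytic, and every analytic subset of every zero-dimensional
Polish space is continuously reducible to it. -/
def IsSigmaOneOneComplete {X : Type*} [TopologicalSpace X] (A : Set X) : Prop :=
  AnalyticSet A ∧
    ∀ (Y : Type) [TopologicalSpace Y] [PolishSpace Y],
      IsTopologicalBasis {s : Set Y | IsClopen s} →
        ∀ B : Set Y, AnalyticSet B → ContinuouslyReducible B A

/-- `A` is `Π¹₁`-complete: it is coanalytic, and every coanalytic subset of every zero-dimensional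
Polish space is continuously reducible to it. -/
def IsPiOneOneComplete {X : Type*} [TopologicalSpace X] (A : Set X) : Prop :=
  CoanalyticSet A ∧
    ∀ (Y : Type) [TopologicalSpace Y] [PolishSpace Y],
      IsTopologicalBasis {s : Set Y | IsClopen s} →
        ∀ B : Set Y, CoanalyticSet B → ContinuouslyReducible B A

/-! ### The specification property -/

/-- The point `y` traces `ε`-close, with gaps `s`, the specification
`⟨x₀, n₀⟩, …, ⟨x_{k-1}, n_{k-1}⟩`. The gap `s j` stands between segment `j` and segment `j + 1`;
the value of `s` at the last index is irrelevant. -/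
def Traces {X : Type*} [MetricSpace X] (T : X → X) (ε : ℝ) {k : ℕ}
    (x : Fin k → X) (n : Fin k → ℕ) (s : Fin k → ℕ) (y : X) : Prop :=
  ∀ j : Fin k, ∀ t < n j,
    dist (T^[(∑ i ∈ Finset.Iio j, (n i + s i)) + t] y) (T^[t] (x j)) < ε

/-- The specification property of `T` (with respect to the metric of `X`). -/
def SpecificationProperty (X : Type*) [MetricSpace X] (T : X → X) : Prop :=
  ∀ ε : ℝ, 0 < ε → ∃ N : ℕ, ∀ k : ℕ, 0 < k →
    ∀ (x : Fin k → X) (n : Fin k → ℕ), (∀ j, 0 < n j) →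
      ∃ (y : X) (s : Fin k → ℕ), (∀ j, s j ≤ N) ∧ Traces T ε x n s y

/-! ### Empirical measures and the sets they define -/

section Generic

variable {X : Type*} [MeasurableSpace X]

/-- The empirical measure `(δ_x + δ_{T x} + ⋯ + δ_{T^{n-1} x}) / n`, for `n ≥ 1`. -/
def empiricalMeasure (T : X → X) (x : X) (n : ℕ) (hn : n ≠ 0) : ProbabilityMeasure X :=
  ⟨(n : ℝ≥0∞)⁻¹ • ∑ i ∈ Finset.range n, Measure.dirac (T^[i] x), ⟨by
    simp [ENNReal.inv_mul_cancel, hn]⟩⟩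

/-- The set `M_T(X)` of `T`-invariant Borel probability measures, as a subset of the space of all
Borel probability measures. -/
def invariantMeasures (T : X → X) : Set (ProbabilityMeasure X) :=
  {μ | ∀ A : Set X, MeasurableSet A → μ (T ⁻¹' A) = μ A}

variable [TopologicalSpace X] [OpensMeasurableSpace X]

/-- `V(x)`: the set of all limit points, in the weak* topology, of the sequence of empirical
measures of `x`, indexed by the positive integers `n + 1`. -/
def limitMeasures (T : X → X) (x : X) : Set (ProbabilityMeasure X) :=
  {μ | MapClusterPt μ atTop (fun n : ℕ => empiricalMeasure T x (n + 1) n.succ_ne_zero)}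

/-- `G^V = {x | V ⊆ V(x)}`. -/
def upperG (T : X → X) (V : Set (ProbabilityMeasure X)) : Set X :=
  {x | V ⊆ limitMeasures T x}

/-- `G_V = {x | V(x) ⊆ V}`. -/
def lowerG (T : X → X) (V : Set (ProbabilityMeasure X)) : Set X :=
  {x | limitMeasures T x ⊆ V}

/-- `G(V) = G^V ∩ G_V`. -/
def genericG (T : X → X) (V : Set (ProbabilityMeasure X)) : Set X :=
  upperG T V ∩ lowerG T V

/-- `^V G = {x | V(x) ∩ V ≠ ∅}`. -/
def hitG (T : X → X) (V : Set (ProbabilityMeasure X)) : Set X :=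
  {x | (limitMeasures T x ∩ V).Nonempty}

end Generic

/-! ### The shift on `ω^ω` -/

/-- The shift map on `ω^ω`. -/
def shift (x : ℕ → ℕ) : ℕ → ℕ := fun n => x (n + 1)

/-- The Dirac measure at the zero sequence. -/
def deltaZero : ProbabilityMeasure (ℕ → ℕ) :=
  ⟨Measure.dirac (fun _ => 0), inferInstance⟩

/-- The usual metric on `ω^ω`: `ρ(x, y) = 2^{-m}` if `x ≠ y` and `m` is the least index with
`x m ≠ y m`. -/
abbrev baireMetric : MetricSpace (ℕ → ℕ) := PiNat.metricSpaceNatNat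

end

end NonCompactGeneric

/-! Limit points of empirical measures are invariant, and an invariant measure other than
`deltaZero` must charge the sequences whose first symbol is nonzero. By Prokhorov's theorem, `x`
therefore has a limit measure other than `deltaZero` exactly when, along some times `M k → ∞`,
nonzero symbols keep a positive frequency while large symbols have uniformly small frequency. This
is `TightNonzero x`. It identifies `hitG` and, by negation, `lowerG`, and it exhibits `hitG` as the
projection of a Borel set of pairs `(x, M)`.

Hardness comes from non-compactness: mass may escape to infinity. An analytic `B` is the set of `y`
whose tree `Tr y` has an infinite branch. `treePoint` spends one even block `[n!, (n+1)!)` on each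
finite sequence `s` and, if `s` is a node of the tree, writes `s m + 1` there with frequency `2 ^
(-(m + 1))`. Each block dwarfs everything before it. Along the nodes of a branch the `m`-th symbol
is eventually fixed, so the empirical measures are tight (`tightNonzero_treePoint`). Conversely,
tightness along nodes bounds each coordinate, and a König argument gives a branch
(`exists_branch_of_tightNonzero`).

The odd blocks are zero, so `deltaZero` is always a limit measure. Hence the same map reduces to
`genericG`. Completeness excludes the dual class by way of the diagonal set, which is analytic but
not coanalytic. -/

namespace NonCompactGeneric

/-! ### Analytic sets as projections of trees -/

/-- The list of the first `n` values of the sequence `x`. -/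
def initSeg (x : ℕ → ℕ) (n : ℕ) : List ℕ := List.ofFn fun i : Fin n => x i

@[simp] lemma length_initSeg (x : ℕ → ℕ) (n : ℕ) : (initSeg x n).length = n := by
  simp [initSeg]

lemma getElem?_initSeg (x : ℕ → ℕ) {n i : ℕ} (h : i < n) : (initSeg x n)[i]? = some (x i) := by
  simp [initSeg, h]

lemma initSeg_eq_iff {x y : ℕ → ℕ} {n : ℕ} : initSeg x n = initSeg y n ↔ ∀ i < n, x i = y i := by
  rw [initSeg, initSeg, List.ofFn_inj, funext_iff]
  exact ⟨fun h i hi => h ⟨i, hi⟩, fun h i => h i i.2⟩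

lemma take_initSeg (x : ℕ → ℕ) (m n : ℕ) : (initSeg x n).take m = initSeg x (min m n) := by
  apply List.ext_getElem?
  intro i
  simp only [initSeg, List.getElem?_take, List.getElem?_ofFn]
  split_ifs <;> grind

lemma isClopen_setOf_initSeg_mem {Y : Type*} [TopologicalSpace Y] {e : Y → ℕ → ℕ}
    (he : Continuous e) (n : ℕ) (S : Set (List ℕ)) : IsClopen {y | initSeg (e y) n ∈ S} := by
  have h : Continuous fun y => fun i : Fin n => e y i := by fun_prop
  exact (isClopen_discrete {u : Fin n → ℕ | List.ofFn u ∈ S}).preimage h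

lemma isTopologicalBasis_isClopen_natNat :
    IsTopologicalBasis {s : Set (ℕ → ℕ) | IsClopen s} := by
  refine isTopologicalBasis_of_isOpen_of_nhds (fun u hu => hu.isOpen) fun x u hx hu => ?_
  obtain ⟨v, ⟨z, n, rfl⟩, hxv, hvu⟩ :=
    (PiNat.isTopologicalBasis_cylinders fun _ => ℕ).exists_subset_of_mem_open hx hu
  refine ⟨_, ?_, hxv, hvu⟩
  convert! isClopen_setOf_initSeg_mem continuous_id n {initSeg z n} using 1
  ext y
  simp [initSeg_eq_iff, PiNat.mem_cylinder_iff]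

/-- A set of pairs of lists that is closed under simultaneous truncation. -/
def PrefixClosed (S : Set (List ℕ × List ℕ)) : Prop :=
  ∀ u v, (u, v) ∈ S → ∀ k, (u.take k, v.take k) ∈ S

/-- `B` is the range of a continuous `f` on Baire space, and `S` collects the initial segments of
the graph of `e ∘ f`. A branch `(e y, α)` of `S` is a limit of points of that graph, which is
closed, so `e (f α) = e y`. Injectivity of `e` suffices; its range need not be closed. -/
lemma exists_prefixClosed_of_analyticSet {Y : Type*} [TopologicalSpace Y] {e : Y → ℕ → ℕ}
    (he : Continuous e) (hinj : Function.Injective e) {B : Set Y} (hB : AnalyticSet B) :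
    ∃ S : Set (List ℕ × List ℕ), PrefixClosed S ∧
      ∀ y, y ∈ B ↔ ∃ α : ℕ → ℕ, ∀ k, (initSeg (e y) k, initSeg α k) ∈ S := by
  rw [AnalyticSet] at hB
  obtain rfl | ⟨f, hf, rfl⟩ := hB
  · exact ⟨∅, fun _ _ h => h.elim, by simp⟩
  refine ⟨{p | ∃ β n, p = (initSeg (e (f β)) n, initSeg β n)}, ?_, fun y => ⟨?_, ?_⟩⟩
  · rintro u v ⟨β, n, h⟩ k
    obtain ⟨rfl, rfl⟩ := Prod.ext_iff.1 h
    exact ⟨β, min k n, by simp [take_initSeg]⟩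
  · rintro ⟨α, rfl⟩
    exact ⟨α, fun k => ⟨α, k, rfl⟩⟩
  · rintro ⟨α, hα⟩
    have key : ∀ k, ∃ β, initSeg (e (f β)) k = initSeg (e y) k ∧ initSeg β k = initSeg α k := by
      intro k
      obtain ⟨β, n, h⟩ := hα k
      obtain ⟨h1, h2⟩ := Prod.ext_iff.1 h
      have hn : k = n := by simpa using congrArg List.length h2
      subst hn
      exact ⟨β, h1.symm, h2.symm⟩
    choose β hβ1 hβ2 using key
    have hlim : Tendsto β atTop (𝓝 α) := by
      rw [tendsto_pi_nhds]
      intro i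
      apply tendsto_const_nhds.congr'
      filter_upwards [eventually_gt_atTop i] with k hk
      exact (initSeg_eq_iff.1 (hβ2 k) i hk).symm
    have h1 : Tendsto (fun k => e (f (β k))) atTop (𝓝 (e (f α))) :=
      ((he.comp hf).tendsto α).comp hlim
    have h2 : Tendsto (fun k => e (f (β k))) atTop (𝓝 (e y)) := by
      rw [tendsto_pi_nhds]
      intro i
      apply tendsto_const_nhds.congr'
      filter_upwards [eventually_gt_atTop i] with k hk
      exact (initSeg_eq_iff.1 (hβ1 k) i hk).symm
    exact ⟨α, hinj (tendsto_nhds_unique h1 h2)⟩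

/-- For each pair of sets from a countable basis that some clopen set separates, one such clopen set
is chosen. These countably many sets separate points, so their indicators form an injective map. -/
lemma exists_continuous_injective_of_isTopologicalBasis_isClopen {Y : Type*} [TopologicalSpace Y]
    [SecondCountableTopology Y] [T1Space Y] (hY : IsTopologicalBasis {s : Set Y | IsClopen s}) :
    ∃ e : Y → ℕ → ℕ, Continuous e ∧ Function.Injective e := by
  classical
  obtain ⟨b, hbc, -, hb⟩ := exists_countable_basis Y
  let C : b × b → Set Y := fun p =>
    if h : ∃ C : Set Y, IsClopen C ∧ (p.1 : Set Y) ⊆ C ∧ (p.2 : Set Y) ⊆ Cᶜ then h.choose else ∅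
  have hC : ∀ p, IsClopen (C p) := by
    intro p
    by_cases h : ∃ C : Set Y, IsClopen C ∧ (p.1 : Set Y) ⊆ C ∧ (p.2 : Set Y) ⊆ Cᶜ
    · simpa [C, h] using h.choose_spec.1
    · simpa [C, h] using isClopen_empty
  have hsep : ∀ x y, x ≠ y → ∃ p, x ∈ C p ∧ y ∉ C p := by
    intro x y hxy
    obtain ⟨D, hD, hxD, hDy⟩ := hY.exists_subset_of_mem_open
      (show x ∈ ({y}ᶜ : Set Y) from hxy) isOpen_compl_singleton
    have hyD : y ∈ Dᶜ := fun h => hDy h rfl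
    obtain ⟨U, hU, hxU, hUD⟩ := hb.exists_subset_of_mem_open hxD (show IsClopen D from hD).isOpen
    obtain ⟨U', hU', hyU', hUD'⟩ :=
      hb.exists_subset_of_mem_open hyD (show IsClopen D from hD).compl.isOpen
    have h : ∃ C : Set Y, IsClopen C ∧ U ⊆ C ∧ U' ⊆ Cᶜ := ⟨D, hD, hUD, hUD'⟩
    refine ⟨(⟨U, hU⟩, ⟨U', hU'⟩), ?_, ?_⟩
    · simpa [C, h] using h.choose_spec.2.1 hxU
    · simpa [C, h] using h.choose_spec.2.2 hyU'
  have : Countable b := hbc.to_subtype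
  let _ : Encodable (b × b) := Encodable.ofCountable _
  let D : ℕ → Set Y := fun n => ⋃ p ∈ Encodable.decode (α := b × b) n, C p
  have hD : ∀ n, IsClopen (D n) := by
    intro n
    rcases h : Encodable.decode (α := b × b) n with _ | p
    · simpa [D, h] using isClopen_empty
    · simpa [D, h] using hC p
  have hDe : ∀ p, D (Encodable.encode p) = C p := by
    intro p
    simp [D]
  refine ⟨fun y n => if y ∈ D n then 1 else 0, ?_, ?_⟩
  · refine continuous_pi fun n => ?_
    refine continuous_const.if ?_ continuous_const
    have := (hD n).frontier_eq
    intro a ha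
    change a ∈ frontier (D n) at ha
    simp [this] at ha
  · intro x y hxy
    by_contra hne
    obtain ⟨p, hx, hy⟩ := hsep x y hne
    have := congrFun hxy (Encodable.encode p)
    simp [hDe, hx, hy] at this

/-! ### An analytic set that is not coanalytic -/

/-- The set of sequences lying in the analytic set that they code. -/
def diagonalSet : Set (ℕ → ℕ) :=
  {z | ∃ α : ℕ → ℕ, ∀ k, z (Encodable.encode (initSeg z k, initSeg α k)) ≠ 0}

lemma analyticSet_diagonalSet : AnalyticSet diagonalSet := by
  have hcl : IsClosed {p : (ℕ → ℕ) × (ℕ → ℕ) |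
      ∀ k, p.1 (Encodable.encode (initSeg p.1 k, initSeg p.2 k)) ≠ 0} := by
    rw [Set.ofPred_forall]
    refine isClosed_iInter fun k => ?_
    -- The position at which `p.1` is read depends on `p`; quantifying over its possible values `q`
    -- leaves only clopen conditions.
    have hset : {p : (ℕ → ℕ) × (ℕ → ℕ) |
        p.1 (Encodable.encode (initSeg p.1 k, initSeg p.2 k)) ≠ 0} =
        ⋂ q : List ℕ × List ℕ, ({p | initSeg p.1 k ∈ ({q.1} : Set (List ℕ))}ᶜ ∪
          {p | initSeg p.2 k ∈ ({q.2} : Set (List ℕ))}ᶜ) ∪ {p | p.1 (Encodable.encode q) ≠ 0} := by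
      ext p
      simp only [Set.mem_iInter, Set.mem_union, Set.mem_compl_iff, Set.mem_singleton_iff,
        Set.mem_ofPred_eq]
      constructor
      · rintro h ⟨u, v⟩
        grind
      · intro h
        have := h (initSeg p.1 k, initSeg p.2 k)
        simpa using this
    rw [hset]
    refine isClosed_iInter fun q => ?_
    refine ((isClopen_setOf_initSeg_mem continuous_fst k _).compl.isClosed.union
      (isClopen_setOf_initSeg_mem continuous_snd k _).compl.isClosed).union ?_
    have hc : Continuous fun p : (ℕ → ℕ) × (ℕ → ℕ) => p.1 (Encodable.encode q) := by fun_prop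
    exact (isClosed_discrete {n : ℕ | n ≠ 0}).preimage hc
  convert! hcl.analyticSet.image_of_continuous continuous_fst
  ext z
  simp [diagonalSet]

lemma not_coanalyticSet_diagonalSet : ¬ CoanalyticSet diagonalSet := by
  classical
  intro h
  obtain ⟨S, -, hS⟩ := exists_prefixClosed_of_analyticSet continuous_id Function.injective_id h
  -- Diagonalization: `z` codes the very set `S` that represents the complement, so `z` belongs to
  -- `diagonalSet` iff it belongs to its complement.
  let z : ℕ → ℕ := fun n =>
    if ∃ p ∈ S, Encodable.encode p = n then 1 else 0
  have hz : ∀ p, z (Encodable.encode p) ≠ 0 ↔ p ∈ S := by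
    intro p
    simp only [z, Encodable.encode_inj, exists_eq_right, ne_eq, ite_eq_right_iff, one_ne_zero,
      imp_false, not_not]
  have h1 := hS z
  have h2 : z ∈ diagonalSet ↔ ∃ α : ℕ → ℕ, ∀ k, (initSeg z k, initSeg α k) ∈ S := by
    simp only [diagonalSet, Set.mem_ofPred_eq, hz]
  simp only [id, ← h2, Set.mem_compl_iff] at h1
  tauto

lemma IsSigmaOneOneComplete.not_coanalyticSet {X : Type*} [TopologicalSpace X] [T2Space X]
    {A : Set X} (hA : IsSigmaOneOneComplete A) : ¬ CoanalyticSet A := by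
  intro h
  obtain ⟨f, hf, hfA⟩ := hA.2 (ℕ → ℕ) isTopologicalBasis_isClopen_natNat
    diagonalSet analyticSet_diagonalSet
  apply not_coanalyticSet_diagonalSet
  rw [CoanalyticSet, ← hfA, ← Set.preimage_compl]
  exact AnalyticSet.preimage h hf

lemma IsPiOneOneComplete.not_analyticSet {X : Type*} [TopologicalSpace X] [T2Space X]
    {A : Set X} (hA : IsPiOneOneComplete A) : ¬ AnalyticSet A := by
  intro h
  obtain ⟨f, hf, hfA⟩ := hA.2 (ℕ → ℕ) isTopologicalBasis_isClopen_natNat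
    diagonalSetᶜ (by simpa [CoanalyticSet] using analyticSet_diagonalSet)
  apply not_coanalyticSet_diagonalSet
  rw [CoanalyticSet, ← hfA]
  exact AnalyticSet.preimage h hf

/-! ### Frequencies of large symbols -/

/-- The number of `i < n` with `g < x i`. -/
def exceed (g : ℕ) (x : ℕ → ℕ) (n : ℕ) : ℕ := ((Finset.range n).filter fun i => g < x i).card

/-- Along some sequence of times, the nonzero symbols of `x` have frequency bounded away from zero
while no mass escapes to infinity. -/
def TightNonzero (x : ℕ → ℕ) : Prop :=
  ∃ M : ℕ → ℕ, (∀ k, 0 < M k) ∧ Tendsto M atTop atTop ∧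
    (∃ q, ∀ᶠ k in atTop, M k ≤ q * exceed 0 x (M k)) ∧
    ∀ j, ∃ g, ∀ᶠ k in atTop, j * exceed g x (M k) ≤ M k

/-! ### The ruler sequence -/

/-- The exponent of `2` in `i + 1`. -/
def ruler (i : ℕ) : ℕ := padicValNat 2 (i + 1)

lemma le_ruler_iff {l i : ℕ} : l ≤ ruler i ↔ 2 ^ l ∣ i + 1 :=
  (padicValNat_dvd_iff_le (p := 2) i.succ_ne_zero).symm

lemma card_filter_le_ruler (l n : ℕ) :
    ((Finset.range n).filter fun i => l ≤ ruler i).card = n / 2 ^ l := by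
  simp only [le_ruler_iff]
  exact Nat.card_multiples n (2 ^ l)

lemma ruler_eq_of_modEq {m i : ℕ} (h : i ≡ 2 ^ m - 1 [MOD 2 ^ (m + 1)]) : ruler i = m := by
  have hpos : 0 < 2 ^ m := by positivity
  have h1 : i + 1 ≡ 2 ^ m [MOD 2 ^ (m + 1)] := by
    have := h.add_right 1
    rwa [Nat.sub_add_cancel hpos] at this
  apply le_antisymm
  · by_contra! hlt
    have h2 : 2 ^ (m + 1) ∣ i + 1 := le_ruler_iff.1 hlt
    have h3 : 2 ^ (m + 1) ∣ 2 ^ m := (h1.dvd_iff dvd_rfl).1 h2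
    have := (Nat.pow_dvd_pow_iff_le_right (x := 2) (by norm_num)).1 h3
    omega
  · rw [le_ruler_iff]
    exact (h1.dvd_iff (pow_dvd_pow 2 m.le_succ)).2 dvd_rfl

/-- The indices with `ruler i = m` contain a full residue class modulo `2 ^ (m + 1)`, so the bound
holds in every window, wherever it begins. -/
lemma le_card_filter_ruler_eq (a L m : ℕ) :
    L / 2 ^ (m + 1) ≤ ((Finset.Ico a (a + L)).filter fun i => ruler i = m).card := by
  have hr : 0 < 2 ^ (m + 1) := by positivity
  have h1 := Nat.Ico_filter_modEq_card a (a + L) hr (2 ^ m - 1)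
  have h2 : ((Finset.Ico a (a + L)).filter fun i => i ≡ 2 ^ m - 1 [MOD 2 ^ (m + 1)]).card ≤
      ((Finset.Ico a (a + L)).filter fun i => ruler i = m).card :=
    Finset.card_le_card (Finset.monotone_filter_right _ fun i _ h => ruler_eq_of_modEq h)
  refine le_trans ?_ h2
  zify
  rw [h1]
  refine le_max_of_le_left ?_
  have hL : ((2 : ℤ) ^ (m + 1)) * ((L : ℤ) / 2 ^ (m + 1)) ≤ L :=
    Int.mul_ediv_self_le (by positivity)
  set Q : ℤ := (L : ℤ) / 2 ^ (m + 1)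
  have hL' : ((2 : ℚ) ^ (m + 1)) * Q ≤ L := by exact_mod_cast hL
  rw [le_sub_iff_add_le, add_comm, ← Int.ceil_add_intCast]
  apply Int.ceil_mono
  push_cast
  have hr' : (0 : ℚ) < 2 ^ (m + 1) := by positivity
  rw [div_add' _ _ _ hr'.ne']
  gcongr
  linarith

/-! ### The point of Baire space attached to a tree -/

/-- The number of the block `[n!, (n+1)!)` containing `i`. -/
def stage (i : ℕ) : ℕ := Nat.findGreatest (fun n => n.factorial ≤ i) i

lemma factorial_stage_le {i : ℕ} (hi : 0 < i) : (stage i).factorial ≤ i :=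
  Nat.findGreatest_spec (P := fun n => n.factorial ≤ i) (Nat.zero_le i) (by simpa using Nat.succ_le_of_lt hi)

lemma lt_factorial_stage_succ (i : ℕ) : i < (stage i + 1).factorial := by
  by_contra! h
  have h1 : stage i + 1 ≤ i := (Nat.self_le_factorial _).trans h
  have := Nat.le_findGreatest (P := fun n => n.factorial ≤ i) h1 h
  unfold stage at *
  omega

lemma stage_eq {n i : ℕ} (h1 : n.factorial ≤ i) (h2 : i < (n + 1).factorial) : stage i = n := by
  have hi : 0 < i := n.factorial_pos.trans_le h1
  have h3 := factorial_stage_le hi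
  have h4 := lt_factorial_stage_succ i
  by_contra hne
  rcases Nat.lt_or_gt_of_ne hne with h | h
  · have := Nat.factorial_le (show stage i + 1 ≤ n from h)
    omega
  · have := Nat.factorial_le (show n + 1 ≤ stage i from h)
    omega

lemma tendsto_stage : Tendsto stage atTop atTop := by
  rw [tendsto_atTop]
  intro b
  filter_upwards [eventually_ge_atTop (b.factorial)] with i hi
  by_contra! h
  have := Nat.factorial_le (show stage i + 1 ≤ b from h)
  have := lt_factorial_stage_succ i
  omega

/-- The finite sequence treated in the blocks `2 * n` and `2 * n + 1`. -/
def stageList (n : ℕ) : List ℕ := Denumerable.ofNat (List ℕ) (n / 2)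

open Classical in
/-- The point attached to a set `S` of finite sequences: on the block of an even number `n` whose
sequence `s` belongs to `S`, the symbol `s m + 1` is used with frequency `2 ^ (-(m + 1))`; all other
symbols are zero. -/
noncomputable def treePoint (S : Set (List ℕ)) (i : ℕ) : ℕ :=
  if stage i % 2 = 0 ∧ stageList (stage i) ∈ S then
    ((stageList (stage i))[ruler i]?).elim 0 (· + 1) else 0

lemma continuous_treePoint {Y : Type*} [TopologicalSpace Y] {S : Y → Set (List ℕ)}
    (hS : ∀ s, IsClopen {y | s ∈ S y}) : Continuous fun y => treePoint (S y) := by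
  classical
  refine continuous_pi fun i => ?_
  by_cases h : stage i % 2 = 0
  · simp only [treePoint, h, true_and]
    refine continuous_const.if ?_ continuous_const
    intro a ha
    simp [(hS _).frontier_eq] at ha
  · simp only [treePoint, h, false_and, if_false]
    exact continuous_const

lemma treePoint_eq_of_odd {S : Set (List ℕ)} {n i : ℕ} (hn : n % 2 = 1) (h1 : n.factorial ≤ i)
    (h2 : i < (n + 1).factorial) : treePoint S i = 0 := by
  simp [treePoint, stage_eq h1 h2, hn]

lemma treePoint_eq_of_even {S : Set (List ℕ)} {n i : ℕ} (hn : n % 2 = 0) (hS : stageList n ∈ S)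
    (h1 : n.factorial ≤ i) (h2 : i < (n + 1).factorial) :
    treePoint S i = ((stageList n)[ruler i]?).elim 0 (· + 1) := by
  simp [treePoint, stage_eq h1 h2, hn, hS]

lemma treePoint_eq_of_notMem {S : Set (List ℕ)} {n i : ℕ} (hS : stageList n ∉ S)
    (h1 : n.factorial ≤ i) (h2 : i < (n + 1).factorial) : treePoint S i = 0 := by
  simp [treePoint, stage_eq h1 h2, hS]

lemma div_le_exceed_treePoint {S : Set (List ℕ)} {n L N m a g : ℕ} (hn : n % 2 = 0)
    (hS : stageList n ∈ S) (hL : n.factorial + L ≤ (n + 1).factorial)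
    (hN : n.factorial + L ≤ N) (ha : (stageList n)[m]? = some a) (hg : g < a + 1) :
    L / 2 ^ (m + 1) ≤ exceed g (treePoint S) N := by
  refine (le_card_filter_ruler_eq n.factorial L m).trans (Finset.card_le_card ?_)
  intro i hi
  simp only [Finset.mem_filter, Finset.mem_Ico, Finset.mem_range] at hi ⊢
  obtain ⟨⟨h1, h2⟩, h3⟩ := hi
  refine ⟨h2.trans_le hN, ?_⟩
  rw [treePoint_eq_of_even hn hS h1 (h2.trans_le hL), h3, ha]
  simpa using hg

lemma tightNonzero_treePoint {S : Set (List ℕ)} {α : ℕ → ℕ} (hα : ∀ k, initSeg α k ∈ S) :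
    TightNonzero (treePoint S) := by
  let n : ℕ → ℕ := fun k => 2 * Encodable.encode (initSeg α k)
  have hlist : ∀ k, stageList (n k) = initSeg α k := by
    intro k
    simp [stageList, n]
  have hn0 : ∀ k, n k % 2 = 0 := fun k => by simp [n]
  have hninj : Function.Injective n := by
    intro k l h
    have h1 := congrArg stageList h
    rw [hlist, hlist] at h1
    simpa using congrArg List.length h1
  have hn : Tendsto n atTop atTop := by
    simpa [Nat.cofinite_eq_atTop] using hninj.tendsto_cofinite
  have hM : ∀ k, (n k + 1).factorial = n k * (n k).factorial + (n k).factorial := fun k => by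
    rw [Nat.factorial_succ]; ring
  -- The times are the ends of the blocks given to the segments of `α`. The symbol `α 0 + 1` fills
  -- about half of such a block, and the block is almost all of `[0, (n k + 1)!)`; the constant 8 is
  -- generous.
  refine ⟨fun k => (n k + 1).factorial, fun k => Nat.factorial_pos _, ?_, ⟨8, ?_⟩, ?_⟩
  · exact (tendsto_atTop_mono Nat.self_le_factorial tendsto_id).comp
      ((tendsto_add_atTop_nat 1).comp hn)
  · filter_upwards [eventually_gt_atTop 0, hn.eventually_ge_atTop 4] with k hk hnk
    have h1 := div_le_exceed_treePoint (S := S) (g := 0) (m := 0) (a := α 0) (hn0 k)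
      (by rw [hlist]; exact hα k) (L := n k * (n k).factorial) (N := (n k + 1).factorial)
      (by rw [hM]; omega) (by rw [hM]; omega) (by rw [hlist, getElem?_initSeg α hk]) (by omega)
    have h2 : 4 * (n k).factorial ≤ n k * (n k).factorial := Nat.mul_le_mul_right _ hnk
    have h3 := (n k).factorial_pos
    rw [hM] at h1 ⊢
    norm_num at h1
    omega
  · intro j
    -- `g` dominates every symbol written at ruler values below `2 * j`. Larger symbols come from
    -- before the block or from ruler values at least `2 * j`; each source contributes at most a
    -- fraction `1 / (2 * j)`.
    let g := ∑ m ∈ Finset.range (2 * j), (α m + 1)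
    refine ⟨g, ?_⟩
    filter_upwards [hn.eventually_ge_atTop (2 * j)] with k hnk
    have hsub : exceed g (treePoint S) (n k + 1).factorial ≤
        (n k).factorial + (n k + 1).factorial / 2 ^ (2 * j) := by
      rw [← card_filter_le_ruler, exceed]
      conv_rhs => rw [← Finset.card_range (n k).factorial]
      refine (Finset.card_le_card ?_).trans (Finset.card_union_le _ _)
      intro i hi
      simp only [Finset.mem_filter, Finset.mem_range, Finset.mem_union] at hi ⊢
      by_contra! hcon
      obtain ⟨h1, h2⟩ := hcon
      have h3 := h2 hi.1
      have hx := hi.2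
      rw [treePoint_eq_of_even (hn0 k) (by rw [hlist]; exact hα k) h1 hi.1, hlist] at hx
      by_cases hr : ruler i < k
      · rw [getElem?_initSeg α hr] at hx
        have : α (ruler i) + 1 ≤ g :=
          Finset.single_le_sum (f := fun m => α m + 1) (fun _ _ => Nat.zero_le _)
            (Finset.mem_range.2 h3)
        simp at hx
        omega
      · rw [List.getElem?_eq_none (by simpa using hr)] at hx
        simp at hx
    set E := exceed g (treePoint S) (n k + 1).factorial
    set N := (n k + 1).factorial with hN
    have h1 : 2 * j * (n k).factorial ≤ N := by
      rw [hN, hM]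
      have := Nat.mul_le_mul_right (n k).factorial hnk
      omega
    have h2 : 2 * j * (N / 2 ^ (2 * j)) ≤ N :=
      (Nat.mul_le_mul_right _ Nat.lt_two_pow_self.le).trans (Nat.mul_div_le _ _)
    have h3 := Nat.mul_le_mul_left (2 * j) hsub
    rw [mul_add] at h3
    change j * E ≤ N
    have h4 : 2 * (j * E) = 2 * j * E := by ring
    omega

/-! ### Extracting a branch -/

/-- König's lemma, with an ultrafilter replacing successive subsequences: each truncation `(s
k).take m` takes finitely many values along it, hence is constant on a large set. These constants
cohere into `α`. -/
lemma exists_branch_of_tendsto_cofinite {S : Set (List ℕ)} (hS : ∀ s ∈ S, ∀ k, s.take k ∈ S)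
    {s : ℕ → List ℕ} (hs : ∀ᶠ k in atTop, s k ∈ S) (hcof : Tendsto s atTop cofinite)
    (hbdd : ∀ m : ℕ, ∃ g : ℕ, ∀ᶠ k in atTop, ∀ a : ℕ, (s k)[m]? = some a → a ≤ g) :
    ∃ α : ℕ → ℕ, ∀ k, initSeg α k ∈ S := by
  let U : Ultrafilter ℕ := Ultrafilter.of atTop
  have hU : (U : Filter ℕ) ≤ atTop := Ultrafilter.of_le atTop
  have key : ∀ m, ∃ u : List ℕ, u.length = m ∧ ∀ᶠ k in (U : Filter ℕ), (s k).take m = u := by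
    intro m
    induction m with
    | zero => exact ⟨[], rfl, by simp⟩
    | succ m ih =>
      obtain ⟨u, hu, hev⟩ := ih
      obtain ⟨g, hg⟩ := hbdd m
      -- Leaving every finite set forces `s k` to extend `u` properly, so an entry at position `m`
      -- exists.
      have hne : ∀ᶠ k in (U : Filter ℕ), s k ≠ u :=
        Filter.Eventually.filter_mono hU (hcof.eventually (Set.finite_singleton u).compl_mem_cofinite)
      have hfin : ∀ᶠ k in (U : Filter ℕ), ∃ a ∈ Set.Iic g, (s k).take (m + 1) = u ++ [a] := by
        filter_upwards [hev, hne, hU hg] with k h1 h2 h3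
        have hlen : m < (s k).length := by
          by_contra! h
          exact h2 (by rw [← h1, List.take_of_length_le h])
        refine ⟨(s k)[m], h3 _ (List.getElem?_eq_getElem hlen), ?_⟩
        rw [List.take_succ_eq_append_getElem hlen, h1]
      obtain ⟨a, -, ha⟩ := (Ultrafilter.eventually_exists_mem_iff (Set.finite_Iic g)).1 hfin
      exact ⟨u ++ [a], by simp [hu], ha⟩
  choose u hu hev using key
  have hpre : ∀ m i, i < m → (u m)[i]? = (u (i + 1))[i]? := by
    intro m i hi
    obtain ⟨k, h1, h2⟩ := ((hev m).and (hev (i + 1))).exists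
    rw [← h1, ← h2]
    simp [hi]
  -- `u (i + 1)` has length `i + 1`, so the default 0 is never used.
  refine ⟨fun i => ((u (i + 1))[i]?).getD 0, fun m => ?_⟩
  obtain ⟨k, h1, h2⟩ := ((hev m).and (hU hs)).exists
  convert hS _ h2 m using 1
  rw [h1]
  apply List.ext_getElem?
  intro i
  by_cases hi : i < m
  · rw [getElem?_initSeg _ hi, hpre m i hi]
    have : i < (u (i + 1)).length := by rw [hu]; omega
    simp [this]
  · rw [List.getElem?_eq_none (by simpa using hi), List.getElem?_eq_none (by rw [hu]; omega)]

/-- Blocks `e - 1` and `e + 1` are odd, hence zero: below `N`, nonzero symbols occur only before `(e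
- 1)!` or inside block `e`. -/
lemma exceed_zero_treePoint_le {S : Set (List ℕ)} {e N : ℕ} (he : e % 2 = 0) (he0 : 0 < e)
    (h1 : e.factorial ≤ N) (h2 : N < (e + 2).factorial) :
    exceed 0 (treePoint S) N ≤ (e - 1).factorial + (min N (e + 1).factorial - e.factorial) ∧
      (stageList e ∉ S → exceed 0 (treePoint S) N ≤ (e - 1).factorial) := by
  obtain ⟨d, rfl⟩ : ∃ d, e = d + 1 := ⟨e - 1, by omega⟩
  have hz : ∀ i, i < N → 0 < treePoint S i → i < d.factorial ∨
      (stageList (d + 1) ∈ S ∧ (d + 1).factorial ≤ i ∧ i < (d + 1 + 1).factorial) := by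
    intro i hi hx
    by_contra! hcon
    obtain ⟨h3, h4⟩ := hcon
    rcases lt_or_ge i (d + 1).factorial with h | h
    · exact hx.ne' (treePoint_eq_of_odd (by omega) h3 h)
    rcases lt_or_ge i (d + 1 + 1).factorial with h' | h'
    · by_cases hS : stageList (d + 1) ∈ S
      · have := h4 hS h
        omega
      · exact hx.ne' (treePoint_eq_of_notMem hS h h')
    · exact hx.ne' (treePoint_eq_of_odd (n := d + 1 + 1) (by omega) h' (hi.trans h2))
  simp only [Nat.add_sub_cancel, exceed]
  constructor
  · conv_rhs => rw [← Nat.card_Ico, ← Finset.card_range d.factorial]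
    refine (Finset.card_le_card ?_).trans (Finset.card_union_le _ _)
    intro i hi
    simp only [Finset.mem_filter, Finset.mem_range, Finset.mem_union, Finset.mem_Ico,
      lt_min_iff] at hi ⊢
    have := hz i hi.1 hi.2
    tauto
  · intro hS
    conv_rhs => rw [← Finset.card_range d.factorial]
    refine Finset.card_le_card fun i hi => ?_
    simp only [Finset.mem_filter, Finset.mem_range] at hi ⊢
    have := hz i hi.1 hi.2
    tauto

lemma exists_branch_of_tightNonzero {S : Set (List ℕ)} (hS : ∀ s ∈ S, ∀ k, s.take k ∈ S)
    (hx : TightNonzero (treePoint S)) : ∃ α : ℕ → ℕ, ∀ k, initSeg α k ∈ S := by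
  obtain ⟨M, hM0, hM, ⟨q, hq⟩, htight⟩ := hx
  let t : ℕ → ℕ := fun k => stage (M k) / 2
  have ht : Tendsto t atTop atTop :=
    (Nat.tendsto_div_const_atTop two_ne_zero).comp (tendsto_stage.comp hM)
  have hstage : ∀ k, (2 * t k).factorial ≤ M k ∧ M k < (2 * t k + 2).factorial := by
    intro k
    refine ⟨(Nat.factorial_le (by simp only [t]; omega)).trans (factorial_stage_le (hM0 k)), ?_⟩
    exact (lt_factorial_stage_succ (M k)).trans_le (Nat.factorial_le (by simp only [t]; omega))
  have hlist : ∀ k, stageList (2 * t k) = Denumerable.ofNat (List ℕ) (t k) := fun k => by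
    simp [stageList]
  -- Once `t k > q`, the part before `(2 * t k - 1)!` supplies at most half of the required nonzero
  -- symbols. The even block must supply the rest, so its list is in `S` and its portion below `M k`
  -- is a fixed fraction of `M k`.
  have main : ∀ᶠ k in atTop, stageList (2 * t k) ∈ S ∧
      M k ≤ 2 * q * (min (M k) (2 * t k + 1).factorial - (2 * t k).factorial) := by
    filter_upwards [hq, ht.eventually_ge_atTop (q + 1)] with k h1 h2
    obtain ⟨h3, h4⟩ := hstage k
    obtain ⟨h5, h6⟩ := exceed_zero_treePoint_le (S := S) (by omega) (by omega) h3 h4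
    have h7 : 2 * q * (2 * t k - 1).factorial ≤ M k := by
      refine (Nat.mul_le_mul_right _ (show 2 * q ≤ 2 * t k by omega)).trans ?_
      rwa [Nat.mul_factorial_pred (by omega)]
    have h8 := Nat.factorial_pos (2 * t k - 1)
    have h9 := hM0 k
    constructor
    · by_contra hcon
      have := Nat.mul_le_mul_left (2 * q) (h6 hcon)
      nlinarith
    · have := Nat.mul_le_mul_left (2 * q) h5
      nlinarith
  refine exists_branch_of_tendsto_cofinite hS (s := fun k => stageList (2 * t k))
    (main.mono fun k h => h.1) ?_ ?_
  · simp only [hlist]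
    have : Tendsto t atTop cofinite := by rwa [Nat.cofinite_eq_atTop]
    exact (Denumerable.eqv (List ℕ)).symm.injective.tendsto_cofinite.comp this
  · intro m
    -- An entry `a > g` at position `m` would give symbols above `g` a frequency of about `1 / (2 *
    -- q * 2 ^ (m + 1))`; the extra factor 2 absorbs the rounding in `L / 2 ^ (m + 1)`.
    obtain ⟨g, hg⟩ := htight (2 * (2 * q * 2 ^ (m + 1)))
    refine ⟨g, ?_⟩
    filter_upwards [main, hg, hM.eventually_ge_atTop (2 * q * 2 ^ (m + 1)),
      ht.eventually_ge_atTop 1] with k h1 h2 h3 ht1 a ha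
    obtain ⟨h4, h5⟩ := hstage k
    by_contra! hag
    have hle : (2 * t k).factorial ≤ (2 * t k + 1).factorial := Nat.factorial_le (by omega)
    have h6 := div_le_exceed_treePoint (S := S) (g := g) (n := 2 * t k)
      (L := min (M k) (2 * t k + 1).factorial - (2 * t k).factorial) (N := M k) (by omega) h1.1
      (by omega) (by omega) ha (by omega)
    set L := min (M k) (2 * t k + 1).factorial - (2 * t k).factorial
    set E := exceed g (treePoint S) (M k)
    have h7 : L < 2 ^ (m + 1) * (E + 1) := by
      have := Nat.lt_mul_div_succ L (show 0 < 2 ^ (m + 1) by positivity)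
      exact this.trans_le (Nat.mul_le_mul_left _ (by omega))
    have hq0 : 0 < q := by
      by_contra! h0
      have := h1.2
      have := hM0 k
      simp_all
    have h8 : M k < 2 * q * 2 ^ (m + 1) * (E + 1) := by
      refine h1.2.trans_lt ?_
      rw [mul_assoc _ (2 ^ (m + 1))]
      exact Nat.mul_lt_mul_of_pos_left h7 (by omega)
    set D := 2 * q * 2 ^ (m + 1)
    have hD : 0 < D := by positivity
    rcases Nat.eq_zero_or_pos E with h0 | h0
    · rw [h0] at h8
      omega
    · nlinarith

/-! ### Empirical measures -/

section Empirical

variable {X : Type*} [MeasurableSpace X]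

lemma empiricalMeasure_real_apply (T : X → X) (x : X) {n : ℕ} (hn : n ≠ 0) {A : Set X}
    [DecidablePred (· ∈ A)] (hA : MeasurableSet A) :
    (empiricalMeasure T x n hn : Measure X).real A =
      ((Finset.range n).filter fun i => T^[i] x ∈ A).card / n := by
  change ((n : ℝ≥0∞)⁻¹ • ∑ i ∈ Finset.range n, Measure.dirac (T^[i] x) : Measure X).real A = _
  rw [measureReal_ennreal_smul_apply, measureReal_def, Measure.finsetSum_apply]
  simp only [Measure.dirac_apply' _ hA, Set.indicator_apply, Pi.one_apply, Finset.sum_boole]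
  simp [div_eq_inv_mul]

lemma integral_empiricalMeasure [TopologicalSpace X] [OpensMeasurableSpace X]
    (T : X → X) (x : X) {n : ℕ} (hn : n ≠ 0) (f : BoundedContinuousFunction X ℝ) :
    ∫ y, f y ∂(empiricalMeasure T x n hn : Measure X) =
      (∑ i ∈ Finset.range n, f (T^[i] x)) / n := by
  change ∫ y, f y ∂((n : ℝ≥0∞)⁻¹ • ∑ i ∈ Finset.range n, Measure.dirac (T^[i] x) : Measure X) = _
  rw [integral_smul_measure, integral_finsetSum_measure fun i _ => f.integrable _]
  have : ∀ i, ∫ y, f y ∂(Measure.dirac (T^[i] x)) = f (T^[i] x) := fun i =>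
    integral_dirac' _ _ f.continuous.stronglyMeasurable
  simp [this, div_eq_inv_mul]

lemma continuous_probabilityMeasure_apply [TopologicalSpace X] [OpensMeasurableSpace X]
    [HasOuterApproxClosed X] {A : Set X} (hA : IsClopen A) :
    Continuous fun ν : ProbabilityMeasure X => (ν : Measure X).real A := by
  rw [continuous_iff_continuousAt]
  intro μ
  have := ProbabilityMeasure.tendsto_measure_of_isClopen_of_tendsto (tendsto_id (x := 𝓝 μ)) hA
  exact (NNReal.continuous_coe.tendsto _).comp this

/-- The integrals of `f ∘ T` and `f` against an empirical measure differ by a telescoping sum, at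
most `2 * ‖f‖ / (n + 1)`; the limit passes to cluster points by continuity. -/
lemma limitMeasures_subset_invariantMeasures [TopologicalSpace X] [BorelSpace X]
    [HasOuterApproxClosed X] {T : X → X} (hT : Continuous T) (x : X) :
    limitMeasures T x ⊆ invariantMeasures T := by
  intro μ hμ
  have hmap : Measure.map T (μ : Measure X) = μ := by
    have : IsFiniteMeasure (Measure.map T (μ : Measure X)) :=
      Measure.isFiniteMeasure_map _ _
    refine ext_of_forall_integral_eq_of_IsFiniteMeasure fun f => ?_
    rw [integral_map hT.aemeasurable f.continuous.aestronglyMeasurable]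
    let fT : BoundedContinuousFunction X ℝ := f.compContinuous ⟨T, hT⟩
    let Φ : ProbabilityMeasure X → ℝ := fun ν =>
      ∫ y, fT y ∂(ν : Measure X) - ∫ y, f y ∂(ν : Measure X)
    have hΦ : Continuous Φ :=
      (ProbabilityMeasure.continuous_integral_boundedContinuousFunction fT).sub
        (ProbabilityMeasure.continuous_integral_boundedContinuousFunction f)
    have hlim : Tendsto (fun n : ℕ => Φ (empiricalMeasure T x (n + 1) n.succ_ne_zero)) atTop
        (𝓝 0) := by
      have hbound : ∀ n : ℕ, |Φ (empiricalMeasure T x (n + 1) n.succ_ne_zero)| ≤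
          2 * ‖f‖ * (1 / ((n : ℝ) + 1)) := by
        intro n
        simp only [Φ]
        rw [integral_empiricalMeasure, integral_empiricalMeasure, ← sub_div,
          ← Finset.sum_sub_distrib]
        have hstep : ∀ i, fT (T^[i] x) - f (T^[i] x) = f (T^[i + 1] x) - f (T^[i] x) := by
          intro i
          rw [Function.iterate_succ_apply']
          rfl
        simp only [hstep]
        rw [Finset.sum_range_sub (fun i => f (T^[i] x)), abs_div, mul_one_div]
        push_cast
        rw [abs_of_pos (show (0 : ℝ) < n + 1 by positivity)]
        gcongr
        have h1 := f.norm_coe_le_norm (T^[n + 1] x)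
        have h2 := f.norm_coe_le_norm (T^[0] x)
        have h3 := norm_sub_le (f (T^[n + 1] x)) (f (T^[0] x))
        rw [Real.norm_eq_abs (_ - _)] at h3
        linarith
      refine squeeze_zero_norm hbound ?_
      simpa using tendsto_one_div_add_atTop_nhds_zero_nat.const_mul (2 * ‖f‖)
    have hcl : MapClusterPt (Φ μ) atTop
        (fun n : ℕ => Φ (empiricalMeasure T x (n + 1) n.succ_ne_zero)) :=
      MapClusterPt.continuousAt_comp hΦ.continuousAt hμ
    have h0 : Φ μ = 0 := by
      have : (𝓝 (Φ μ) ⊓ 𝓝 0).NeBot := hcl.neBot.mono (inf_le_inf_left _ hlim)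
      exact eq_of_nhds_neBot this
    exact sub_eq_zero.1 h0
  intro A hA
  have h1 : (μ : Measure X) (T ⁻¹' A) = (μ : Measure X) A := by
    conv_rhs => rw [← hmap, Measure.map_apply hT.measurable hA]
  exact congrArg ENNReal.toNNReal h1

end Empirical

/-! ### The shift -/

lemma continuous_shift : Continuous shift := by
  unfold shift
  fun_prop

lemma iterate_shift_apply (x : ℕ → ℕ) (i n : ℕ) : shift^[i] x n = x (n + i) := by
  induction i generalizing x with
  | zero => rfl
  | succ i ih =>
    rw [Function.iterate_succ_apply, ih]
    change x (n + i + 1) = _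
    rfl

lemma isClopen_setOf_lt_apply (g i : ℕ) : IsClopen {y : ℕ → ℕ | g < y i} := by
  have hc : Continuous fun y : ℕ → ℕ => y i := by fun_prop
  exact (isClopen_discrete {n | g < n}).preimage hc

lemma measurableSet_setOf_lt_apply (g i : ℕ) : MeasurableSet {y : ℕ → ℕ | g < y i} :=
  (isClopen_setOf_lt_apply g i).isOpen.measurableSet

lemma empiricalMeasure_shift_real_setOf_lt (x : ℕ → ℕ) {n : ℕ} (hn : n ≠ 0) (g : ℕ) :
    (empiricalMeasure shift x n hn : Measure (ℕ → ℕ)).real {y | g < y 0} = exceed g x n / n := by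
  classical
  rw [empiricalMeasure_real_apply _ _ _ (measurableSet_setOf_lt_apply g 0)]
  simp [iterate_shift_apply, exceed]

lemma empiricalMeasure_shift_real_setOf_lt_apply_le (x : ℕ → ℕ) {n : ℕ} (hn : n ≠ 0) (g i : ℕ) :
    (empiricalMeasure shift x n hn : Measure (ℕ → ℕ)).real {y | g < y i} ≤
      (exceed g x n + i) / n := by
  classical
  rw [empiricalMeasure_real_apply _ _ _ (measurableSet_setOf_lt_apply g i)]
  gcongr
  have : ((Finset.range n).filter fun l => shift^[l] x ∈ {y : ℕ → ℕ | g < y i}).card ≤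
      exceed g x n + i := by
    -- Reading coordinate `i` moves the window `[0, n)` to `[i, n + i)`, which adds at most `i` new
    -- positions.
    have hinj : Set.InjOn (fun l => i + l)
        (((Finset.range n).filter fun l => shift^[l] x ∈ {y : ℕ → ℕ | g < y i} : Finset ℕ) :
          Set ℕ) := fun a _ b _ h => by simpa using h
    rw [← Finset.card_image_of_injOn hinj, exceed]
    have hcard : (Finset.Ico n (n + i)).card = i := by simp
    conv_rhs => rw [← hcard]
    refine (Finset.card_le_card ?_).trans (Finset.card_union_le _ _)
    intro j hj
    simp only [Finset.mem_image, Finset.mem_filter, Finset.mem_range, Set.mem_ofPred_eq,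
      iterate_shift_apply, Finset.mem_union, Finset.mem_Ico] at hj ⊢
    obtain ⟨l, ⟨h1, h2⟩, rfl⟩ := hj
    by_cases h : i + l < n
    · exact Or.inl ⟨h, h2⟩
    · right; omega
  rw [← Nat.cast_add, Nat.cast_le]
  convert! this

lemma deltaZero_mem_invariantMeasures : deltaZero ∈ invariantMeasures shift := by
  intro A hA
  have : (deltaZero : Measure (ℕ → ℕ)) (shift ⁻¹' A) = (deltaZero : Measure (ℕ → ℕ)) A := by
    change Measure.dirac _ _ = Measure.dirac _ _
    rw [Measure.dirac_apply' _ hA, Measure.dirac_apply' _ (continuous_shift.measurable hA)]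
    rfl
  exact congrArg ENNReal.toNNReal this

lemma deltaZero_real_setOf_lt (g : ℕ) : (deltaZero : Measure (ℕ → ℕ)).real {y | g < y 0} = 0 := by
  change (Measure.dirac _).real _ = 0
  simp [measureReal_def, Measure.dirac_apply' _ (measurableSet_setOf_lt_apply g 0)]

/-- Invariance carries the null set from coordinate 0 to every coordinate. -/
lemma eq_deltaZero_of_invariant {μ : ProbabilityMeasure (ℕ → ℕ)}
    (hμ : μ ∈ invariantMeasures shift) (h0 : (μ : Measure (ℕ → ℕ)).real {y | 0 < y 0} = 0) :
    μ = deltaZero := by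
  have hz : ∀ i, (μ : Measure (ℕ → ℕ)) {y | 0 < y i} = 0 := by
    intro i
    induction i with
    | zero => exact (measureReal_eq_zero_iff (measure_ne_top _ _)).1 h0
    | succ i ih =>
      have := hμ _ (measurableSet_setOf_lt_apply 0 i)
      have h2 : μ {y : ℕ → ℕ | 0 < y i} = 0 := by
        change ENNReal.toNNReal _ = 0
        rw [ih]; rfl
      rw [h2] at this
      exact (ProbabilityMeasure.null_iff_toMeasure_null μ _).1 this
  have hae : ∀ᵐ y ∂(μ : Measure (ℕ → ℕ)), y = fun _ => 0 := by
    have h1 : ∀ᵐ y ∂(μ : Measure (ℕ → ℕ)), ∀ i, ¬ 0 < y i := by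
      rw [ae_all_iff]
      intro i
      rw [ae_iff]
      simpa only [not_not] using hz i
    filter_upwards [h1] with y hy
    funext i
    have := hy i
    omega
  apply Subtype.ext
  change (μ : Measure (ℕ → ℕ)) = Measure.dirac _
  refine Measure.ext fun A hA => ?_
  rw [Measure.dirac_apply' _ hA]
  by_cases h : (fun _ => 0 : ℕ → ℕ) ∈ A
  · rw [Set.indicator_of_mem h]
    have : ∀ᵐ y ∂(μ : Measure (ℕ → ℕ)), y ∈ A := by
      filter_upwards [hae] with y hy
      rwa [hy]
    exact (prob_compl_eq_zero_iff hA).1 this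
  · rw [Set.indicator_of_notMem h]
    have : ∀ᵐ y ∂(μ : Measure (ℕ → ℕ)), y ∉ A := by
      filter_upwards [hae] with y hy
      rwa [hy]
    simpa [ae_iff] using this

lemma exists_real_setOf_lt_lt (μ : Measure (ℕ → ℕ)) [IsFiniteMeasure μ] {δ : ℝ} (hδ : 0 < δ) :
    ∃ g : ℕ, μ.real {y | g < y 0} < δ := by
  have h := tendsto_measure_iInter_atTop (μ := μ) (s := fun g : ℕ => {y : ℕ → ℕ | g < y 0})
    (fun g => (measurableSet_setOf_lt_apply g 0).nullMeasurableSet)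
    (fun g g' hg y hy => hg.trans_lt hy) ⟨0, measure_ne_top _ _⟩
  have hempty : ⋂ g : ℕ, {y : ℕ → ℕ | g < y 0} = ∅ := by
    ext y
    simp only [Set.mem_iInter, Set.mem_ofPred_eq, Set.mem_empty_iff_false, iff_false, not_forall]
    exact ⟨y 0, lt_irrefl _⟩
  rw [hempty, measure_empty] at h
  have h' := (ENNReal.tendsto_toReal ENNReal.zero_ne_top).comp h
  exact (h'.eventually (gt_mem_nhds hδ)).exists

lemma tightNonzero_of_mem_limitMeasures {x : ℕ → ℕ} {μ : ProbabilityMeasure (ℕ → ℕ)}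
    (hμ : μ ∈ limitMeasures shift x) (hne : μ ≠ deltaZero) : TightNonzero x := by
  have hinv := limitMeasures_subset_invariantMeasures continuous_shift x hμ
  have hpos : 0 < (μ : Measure (ℕ → ℕ)).real {y | 0 < y 0} :=
    lt_of_le_of_ne measureReal_nonneg fun h => hne (eq_deltaZero_of_invariant hinv h.symm)
  obtain ⟨q, hq⟩ := exists_nat_one_div_lt hpos
  have hg : ∀ j : ℕ, ∃ g : ℕ, (μ : Measure (ℕ → ℕ)).real {y | g < y 0} < 1 / ((j : ℝ) + 1) :=
    fun j => exists_real_setOf_lt_lt _ (by positivity)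
  choose g hg using hg
  -- A weak* neighbourhood handles only finitely many thresholds, so the `k`-th time is required to
  -- respect those with `j < k`.
  have hfreq : ∀ k : ℕ, ∃ n : ℕ, k ≤ n ∧ n + 1 ≤ (q + 1) * exceed 0 x (n + 1) ∧
      ∀ j < k, (j + 1) * exceed (g j) x (n + 1) ≤ n + 1 := by
    intro k
    have hnhds : ∀ᶠ ν : ProbabilityMeasure (ℕ → ℕ) in 𝓝 μ,
        1 / ((q : ℝ) + 1) < (ν : Measure (ℕ → ℕ)).real {y | 0 < y 0} ∧
        ∀ j < k, (ν : Measure (ℕ → ℕ)).real {y | g j < y 0} < 1 / ((j : ℝ) + 1) := by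
      refine Filter.Eventually.and ?_ ?_
      · exact (continuous_probabilityMeasure_apply (isClopen_setOf_lt_apply 0 0)).continuousAt
          |>.eventually (lt_mem_nhds hq)
      · refine (Set.finite_lt_nat k).eventually_all.2 fun j _ => ?_
        exact (continuous_probabilityMeasure_apply (isClopen_setOf_lt_apply (g j) 0)).continuousAt
          |>.eventually (gt_mem_nhds (hg j))
    have := (mapClusterPt_iff_frequently.1 hμ _ hnhds).and_eventually (eventually_ge_atTop k)
    obtain ⟨n, ⟨h1, h2⟩, hk⟩ := this.exists
    rw [empiricalMeasure_shift_real_setOf_lt] at h1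
    refine ⟨n, hk, ?_, fun j hj => ?_⟩
    · rw [div_lt_div_iff₀ (by positivity) (by positivity)] at h1
      have : ((n + 1 : ℕ) : ℝ) ≤ (((q + 1) * exceed 0 x (n + 1) : ℕ) : ℝ) := by
        push_cast at h1 ⊢
        linarith
      exact_mod_cast this
    · have h3 := h2 j hj
      rw [empiricalMeasure_shift_real_setOf_lt,
        div_lt_div_iff₀ (by positivity) (by positivity)] at h3
      have : (((j + 1) * exceed (g j) x (n + 1) : ℕ) : ℝ) ≤ ((n + 1 : ℕ) : ℝ) := by
        push_cast at h3 ⊢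
        linarith
      exact_mod_cast this
  choose n hkn hn1 hn2 using hfreq
  refine ⟨fun k => n k + 1, fun k => Nat.succ_pos _, ?_, ⟨q + 1, .of_forall hn1⟩, fun j => ?_⟩
  · exact tendsto_atTop_mono (fun k => (hkn k).trans (Nat.le_succ _)) tendsto_id
  · refine ⟨g j, ?_⟩
    filter_upwards [eventually_gt_atTop j] with k hk
    exact (Nat.mul_le_mul_right _ j.le_succ).trans (hn2 k j hk)

/-! ### Limit measures along tight subsequences -/

lemma exists_uniform_coordinate_bound {x : ℕ → ℕ} {M : ℕ → ℕ} (hM0 : ∀ k, 0 < M k)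
    (hM : Tendsto M atTop atTop)
    (htight : ∀ j, ∃ g, ∀ᶠ k in atTop, j * exceed g x (M k) ≤ M k) (i : ℕ) {δ : ℝ} (hδ : 0 < δ) :
    ∃ h : ℕ, ∀ k, (empiricalMeasure shift x (M k) (hM0 k).ne' : Measure (ℕ → ℕ)).real
      {y | h < y i} ≤ δ := by
  classical
  obtain ⟨j, hj⟩ := exists_nat_one_div_lt (half_pos hδ)
  obtain ⟨g, hg⟩ := htight (j + 1)
  have hM' : Tendsto (fun k => (i : ℝ) / M k) atTop (𝓝 0) :=
    tendsto_const_nhds.div_atTop (tendsto_natCast_atTop_atTop.comp hM)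
  obtain ⟨k₀, hk₀⟩ := eventually_atTop.1 (hg.and (hM'.eventually (gt_mem_nhds (half_pos hδ))))
  -- The first `k₀` measures escape the eventual bound, but they read only positions below `B`,
  -- where `x` is bounded.
  let B := ∑ k ∈ Finset.range k₀, (M k + i)
  let h := max g (∑ l ∈ Finset.range B, x l)
  refine ⟨h, fun k => ?_⟩
  rcases le_or_gt k₀ k with hk | hk
  · obtain ⟨h1, h2⟩ := hk₀ k hk
    have hMk : (0 : ℝ) < M k := by exact_mod_cast hM0 k
    refine (measureReal_mono (s₂ := {y : ℕ → ℕ | g < y i})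
      fun y hy => show g < y i from (le_max_left _ _).trans_lt hy).trans ?_
    refine (empiricalMeasure_shift_real_setOf_lt_apply_le x _ g i).trans ?_
    have h3 : (exceed g x (M k) : ℝ) / M k ≤ 1 / (j + 1) := by
      rw [div_le_div_iff₀ hMk (by positivity)]
      have : (((j + 1) * exceed g x (M k) : ℕ) : ℝ) ≤ M k := by exact_mod_cast h1
      push_cast at this
      linarith
    rw [add_div]
    linarith
  · rw [empiricalMeasure_real_apply _ _ _ (measurableSet_setOf_lt_apply h i),
      Finset.filter_false_of_mem]
    · simpa using hδ.le
    · intro l hl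
      rw [Finset.mem_range] at hl
      have hB : M k + i ≤ B :=
        Finset.single_le_sum (f := fun k => M k + i) (fun _ _ => Nat.zero_le _)
          (Finset.mem_range.2 hk)
      have hx : x (i + l) ≤ ∑ l ∈ Finset.range B, x l :=
        Finset.single_le_sum (f := x) (fun _ _ => Nat.zero_le _)
          (Finset.mem_range.2 (by omega))
      have hh : x (i + l) ≤ h := hx.trans (le_max_right _ _)
      simpa [iterate_shift_apply] using hh

/-- A product of finite sets is compact, and summable errors `δ i` control the mass outside it. -/
lemma isTightMeasureSet_of_uniform_coordinate_bound {P : Set (Measure (ℕ → ℕ))}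
    (hfin : ∀ μ ∈ P, IsFiniteMeasure μ)
    (hP : ∀ i : ℕ, ∀ δ : ℝ, 0 < δ → ∃ h : ℕ, ∀ μ ∈ P, μ.real {y | h < y i} ≤ δ) :
    IsTightMeasureSet P := by
  rw [isTightMeasureSet_iff_exists_isCompact_measure_compl_le]
  intro ε hε
  obtain ⟨δ, hδ0, hδ⟩ := ENNReal.exists_pos_sum_of_countable hε.ne' ℕ
  choose h hh using fun i => hP i (δ i) (hδ0 i)
  refine ⟨Set.univ.pi fun i => Set.Iic (h i),
    isCompact_univ_pi fun i => (Set.finite_Iic (h i)).isCompact, fun μ hμ => ?_⟩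
  have := hfin μ hμ
  have hsub : (Set.univ.pi fun i => Set.Iic (h i))ᶜ ⊆ ⋃ i, {y : ℕ → ℕ | h i < y i} := by
    intro y hy
    simpa [Pi.le_def] using hy
  refine (measure_mono hsub).trans ((measure_iUnion_le _).trans ?_)
  refine (ENNReal.tsum_le_tsum fun i => ?_).trans hδ.le
  rw [← ofReal_measureReal]
  exact ENNReal.ofReal_le_of_le_toReal (by simpa using hh i μ hμ)

lemma exists_mem_limitMeasures_of_tightNonzero {x : ℕ → ℕ} (hx : TightNonzero x) :
    ∃ μ ∈ limitMeasures shift x, μ ≠ deltaZero := by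
  obtain ⟨M, hM0, hM, ⟨q, hq⟩, htight⟩ := hx
  let ν : ℕ → ProbabilityMeasure (ℕ → ℕ) := fun k => empiricalMeasure shift x (M k) (hM0 k).ne'
  have ht : IsTightMeasureSet {((μ : ProbabilityMeasure (ℕ → ℕ)) : Measure (ℕ → ℕ)) |
      μ ∈ Set.range ν} := by
    refine isTightMeasureSet_of_uniform_coordinate_bound ?_ fun i δ hδ => ?_
    · rintro _ ⟨μ, -, rfl⟩
      infer_instance
    · obtain ⟨h, hh⟩ := exists_uniform_coordinate_bound hM0 hM htight i hδ
      refine ⟨h, ?_⟩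
      rintro _ ⟨_, ⟨k, rfl⟩, rfl⟩
      exact hh k
  obtain ⟨μ, -, hμ⟩ := (isCompact_closure_of_isTightMeasureSet ht).exists_mapClusterPt
    (f := atTop) (u := ν) (by
      rw [le_principal_iff]
      exact Filter.mem_map.2 (Filter.Eventually.of_forall fun k => subset_closure ⟨k, rfl⟩))
  refine ⟨μ, ?_, ?_⟩
  · have hM1 : Tendsto (fun k => M k - 1) atTop atTop := (tendsto_sub_atTop_nat 1).comp hM
    refine MapClusterPt.of_comp hM1 ?_
    convert hμ using 1
    funext k
    simp only [Function.comp, ν]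
    congr 1
    exact Nat.sub_add_cancel (hM0 k)
  · rintro rfl
    have hq1 : (0 : ℝ) < 1 / (q + 1) := by positivity
    have hnhds : ∀ᶠ ρ : ProbabilityMeasure (ℕ → ℕ) in 𝓝 deltaZero,
        (ρ : Measure (ℕ → ℕ)).real {y | 0 < y 0} < 1 / (q + 1) := by
      refine (continuous_probabilityMeasure_apply (isClopen_setOf_lt_apply 0 0)).continuousAt
        |>.eventually (gt_mem_nhds ?_)
      simpa only [deltaZero_real_setOf_lt] using hq1
    obtain ⟨k, h1, h2⟩ := ((mapClusterPt_iff_frequently.1 hμ _ hnhds).and_eventually hq).exists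
    simp only [ν] at h1
    have hMk : (0 : ℝ) < M k := by exact_mod_cast hM0 k
    rw [Set.mem_ofPred_eq, empiricalMeasure_shift_real_setOf_lt,
      div_lt_div_iff₀ hMk (by positivity)] at h1
    have h3 : (M k : ℝ) ≤ q * exceed 0 x (M k) := by exact_mod_cast h2
    have h4 : (0 : ℝ) ≤ exceed 0 x (M k) := by positivity
    linarith

lemma hitG_eq_setOf_tightNonzero :
    hitG shift (invariantMeasures shift \ {deltaZero}) = {x | TightNonzero x} := by
  ext x
  constructor
  · rintro ⟨μ, hμ, -, hne⟩
    exact tightNonzero_of_mem_limitMeasures hμ hne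
  · intro hx
    obtain ⟨μ, hμ, hne⟩ := exists_mem_limitMeasures_of_tightNonzero hx
    exact ⟨μ, hμ, limitMeasures_subset_invariantMeasures continuous_shift x hμ, hne⟩

lemma lowerG_eq_setOf_not_tightNonzero :
    lowerG shift {deltaZero} = {x | ¬ TightNonzero x} := by
  ext x
  constructor
  · intro h hx
    obtain ⟨μ, hμ, hne⟩ := exists_mem_limitMeasures_of_tightNonzero hx
    exact hne (h hμ)
  · intro hx μ hμ
    by_contra hne
    exact hx (tightNonzero_of_mem_limitMeasures hμ hne)

/-! ### Analyticity -/

lemma measurable_exceed (g : ℕ) :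
    Measurable fun p : (ℕ → ℕ) × ℕ => exceed g p.1 p.2 := by
  refine measurable_from_prod_countable_left fun n => ?_
  simp only [exceed, Finset.card_filter]
  refine Finset.measurable_fun_sum _ fun i _ => ?_
  exact Measurable.ite (measurableSet_setOf_lt_apply g i) measurable_const measurable_const

lemma analyticSet_setOf_tightNonzero : AnalyticSet {x | TightNonzero x} := by
  have hM : ∀ k, Measurable fun p : (ℕ → ℕ) × (ℕ → ℕ) => p.2 k := fun k =>
    (measurable_pi_apply k).comp measurable_snd
  have hE : ∀ g k, Measurable fun p : (ℕ → ℕ) × (ℕ → ℕ) => exceed g p.1 (p.2 k) := fun g k =>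
    (measurable_exceed g).comp (measurable_fst.prodMk (hM k))
  have hmeas : MeasurableSet {p : (ℕ → ℕ) × (ℕ → ℕ) | (∀ k, 0 < p.2 k) ∧
      (∀ b, ∃ k₀, ∀ k ≥ k₀, b ≤ p.2 k) ∧
      (∃ q, ∃ k₀, ∀ k ≥ k₀, p.2 k ≤ q * exceed 0 p.1 (p.2 k)) ∧
      ∀ j, ∃ g, ∃ k₀, ∀ k ≥ k₀, j * exceed g p.1 (p.2 k) ≤ p.2 k} := by
    rw [measurableSet_setOfPred]
    refine Measurable.and ?_ (Measurable.and ?_ (Measurable.and ?_ ?_))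
    · exact Measurable.forall fun k => measurableSet_setOfPred.1 (measurableSet_lt measurable_const (hM k))
    · exact Measurable.forall fun b => Measurable.exists fun k₀ => Measurable.forall fun k =>
        Measurable.forall fun _ => measurableSet_setOfPred.1 (measurableSet_le measurable_const (hM k))
    · exact Measurable.exists fun q => Measurable.exists fun k₀ => Measurable.forall fun k =>
        Measurable.forall fun _ =>
          measurableSet_setOfPred.1 (measurableSet_le (hM k) (measurable_const.mul (hE 0 k)))
    · exact Measurable.forall fun j => Measurable.exists fun g => Measurable.exists fun k₀ =>
        Measurable.forall fun k => Measurable.forall fun _ =>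
          measurableSet_setOfPred.1 (measurableSet_le (measurable_const.mul (hE g k)) (hM k))
  convert! hmeas.analyticSet.image_of_continuous continuous_fst
  ext x
  simp only [TightNonzero, tendsto_atTop, eventually_atTop, Set.mem_image, Set.mem_ofPred_eq,
    Prod.exists, exists_and_right, exists_eq_right]

/-! ### The Dirac measure at zero as a limit measure -/

/-- By the portmanteau criterion only closed sets missing the zero sequence matter. Such a set
misses a cylinder about it, so finitely many coordinates bound its mass. The resulting condition is
visibly Borel in `x`. -/
lemma deltaZero_mem_limitMeasures_iff {x : ℕ → ℕ} :
    deltaZero ∈ limitMeasures shift x ↔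
      ∀ j : ℕ, ∃ n ≥ j, (j + 1) * exceed 0 x (n + 1) ≤ n + 1 := by
  constructor
  · intro hμ j
    have hj : (0 : ℝ) < 1 / (j + 1) := by positivity
    have hnhds : ∀ᶠ ρ : ProbabilityMeasure (ℕ → ℕ) in 𝓝 deltaZero,
        (ρ : Measure (ℕ → ℕ)).real {y | 0 < y 0} < 1 / (j + 1) := by
      refine (continuous_probabilityMeasure_apply (isClopen_setOf_lt_apply 0 0)).continuousAt
        |>.eventually (gt_mem_nhds ?_)
      simpa only [deltaZero_real_setOf_lt] using hj
    obtain ⟨n, h1, h2⟩ := ((mapClusterPt_iff_frequently.1 hμ _ hnhds).and_eventually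
      (eventually_ge_atTop j)).exists
    refine ⟨n, h2, ?_⟩
    rw [Set.mem_ofPred_eq, empiricalMeasure_shift_real_setOf_lt,
      div_lt_div_iff₀ (by positivity) (by positivity)] at h1
    have : (((j + 1) * exceed 0 x (n + 1) : ℕ) : ℝ) ≤ ((n + 1 : ℕ) : ℝ) := by
      push_cast at h1 ⊢
      linarith
    exact_mod_cast this
  · intro h
    choose n hn hexc using h
    have hn' : Tendsto n atTop atTop := tendsto_atTop_mono hn tendsto_id
    refine MapClusterPt.of_comp hn' (Tendsto.mapClusterPt ?_)
    refine tendsto_of_forall_isClosed_limsup_real_le' fun F hF => ?_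
    by_cases h0 : (fun _ => 0 : ℕ → ℕ) ∈ F
    · have h1 : (deltaZero : Measure (ℕ → ℕ)).real F = 1 := by
        change (Measure.dirac _).real F = 1
        simp [measureReal_def, Measure.dirac_apply' _ hF.measurableSet, h0]
      rw [h1]
      refine limsup_le_of_le ?_ (.of_forall fun n => measureReal_le_one)
      exact isCoboundedUnder_le_of_le _ fun n => measureReal_nonneg
    · obtain ⟨_, ⟨z, m, rfl⟩, hz, hzF⟩ :=
        (PiNat.isTopologicalBasis_cylinders fun _ => ℕ).exists_subset_of_mem_open
          (show (fun _ => 0 : ℕ → ℕ) ∈ Fᶜ from h0) hF.isOpen_compl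
      have hFm : F ⊆ ⋃ i ∈ Finset.range m, {y : ℕ → ℕ | 0 < y i} := by
        intro y hy
        by_contra hcon
        simp only [Finset.mem_range, Set.mem_iUnion, Set.mem_ofPred_eq, not_exists, not_lt,
          Nat.le_zero] at hcon
        refine hzF ?_ hy
        rw [PiNat.mem_cylinder_iff] at hz ⊢
        intro i hi
        rw [hcon i hi, ← hz i hi]
      have hlim : Tendsto (fun k => (empiricalMeasure shift x (n k + 1) (n k).succ_ne_zero :
          Measure (ℕ → ℕ)).real F) atTop (𝓝 0) := by
        have hb : Tendsto (fun k : ℕ => (m : ℝ) * (1 + m) * (1 / ((k : ℝ) + 1))) atTop (𝓝 0) := by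
          simpa using (tendsto_one_div_add_atTop_nhds_zero_nat (𝕜 := ℝ)).const_mul
            ((m : ℝ) * (1 + m))
        refine squeeze_zero (fun k => measureReal_nonneg) (fun k => ?_) hb
        refine (measureReal_mono hFm (measure_ne_top _ _)).trans
          ((measureReal_biUnion_finset_le _ _).trans ?_)
        have hterm : ∀ i ∈ Finset.range m,
            (empiricalMeasure shift x (n k + 1) (n k).succ_ne_zero : Measure (ℕ → ℕ)).real
              {y | 0 < y i} ≤ (1 + m) * (1 / ((k : ℝ) + 1)) := by
          intro i hi
          refine (empiricalMeasure_shift_real_setOf_lt_apply_le x _ 0 i).trans ?_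
          rw [mul_one_div, div_le_div_iff₀ (by positivity) (by positivity)]
          have h1 : (((k + 1) * exceed 0 x (n k + 1) : ℕ) : ℝ) ≤ ((n k + 1 : ℕ) : ℝ) := by
            exact_mod_cast hexc k
          have h2 : (i : ℝ) ≤ m := by exact_mod_cast (Finset.mem_range.1 hi).le
          have h3 : (k : ℝ) ≤ n k := by exact_mod_cast hn k
          have h4 : (i : ℝ) * (k + 1) ≤ m * (n k + 1) := by gcongr
          push_cast at h1 ⊢
          linarith
        refine (Finset.sum_le_sum hterm).trans (le_of_eq ?_)
        simp [mul_assoc]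
      change limsup (fun k => (empiricalMeasure shift x (n k + 1) (n k).succ_ne_zero :
          Measure (ℕ → ℕ)).real F) atTop ≤ _
      rw [hlim.limsup_eq]
      exact measureReal_nonneg

lemma deltaZero_mem_limitMeasures_treePoint (S : Set (List ℕ)) :
    deltaZero ∈ limitMeasures shift (treePoint S) := by
  -- At time `(2 * j + 2)!` a zero block has just ended, so all nonzero symbols lie among the first
  -- `(2 * j + 1)!`.
  refine deltaZero_mem_limitMeasures_iff.2 fun j => ⟨(2 * j + 2).factorial - 1, ?_, ?_⟩
  · have := Nat.self_le_factorial (2 * j + 2)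
    omega
  · rw [Nat.sub_add_cancel (Nat.factorial_pos _)]
    have hle : exceed 0 (treePoint S) (2 * j + 2).factorial ≤ (2 * j + 1).factorial := by
      conv_rhs => rw [← Finset.card_range (2 * j + 1).factorial]
      refine Finset.card_le_card fun i hi => ?_
      simp only [Finset.mem_filter, Finset.mem_range] at hi ⊢
      by_contra! hcon
      exact hi.2.ne' (treePoint_eq_of_odd (by omega) hcon hi.1)
    refine (Nat.mul_le_mul_left _ hle).trans ?_
    rw [Nat.factorial_succ (2 * j + 1)]
    exact Nat.mul_le_mul_right _ (by omega)

lemma upperG_eq_setOf :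
    upperG shift {deltaZero} =
      {x | ∀ j : ℕ, ∃ n ≥ j, (j + 1) * exceed 0 x (n + 1) ≤ n + 1} := by
  ext x
  simp only [upperG, Set.singleton_subset_iff, Set.mem_ofPred_eq, deltaZero_mem_limitMeasures_iff]

lemma measurableSet_upperG : MeasurableSet (upperG shift {deltaZero}) := by
  rw [upperG_eq_setOf, measurableSet_setOfPred]
  have hE : ∀ n, Measurable fun x : ℕ → ℕ => exceed 0 x n := fun n =>
    (measurable_exceed 0).comp (measurable_id.prodMk measurable_const)
  exact Measurable.forall fun j => Measurable.exists fun n => measurable_const.and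
    (measurableSet_setOfPred.1 (measurableSet_le (measurable_const.mul (hE _)) measurable_const))

/-! ### Completeness -/

/-- Every analytic subset of a zero-dimensional Polish space is reduced to the set of sequences with
a limit measure other than the Dirac measure at zero, by a map into the sequences having the
Dirac measure at zero as a limit. -/
lemma exists_reduction {Y : Type*} [TopologicalSpace Y] [PolishSpace Y]
    (hY : IsTopologicalBasis {s : Set Y | IsClopen s}) {B : Set Y} (hB : AnalyticSet B) :
    ∃ f : Y → ℕ → ℕ, Continuous f ∧ (∀ y, TightNonzero (f y) ↔ y ∈ B) ∧
      ∀ y, deltaZero ∈ limitMeasures shift (f y) := by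
  obtain ⟨e, he, hinj⟩ := exists_continuous_injective_of_isTopologicalBasis_isClopen hY
  obtain ⟨S, hS, hSB⟩ := exists_prefixClosed_of_analyticSet he hinj hB
  let Tr : Y → Set (List ℕ) := fun y => {v | (initSeg (e y) v.length, v) ∈ S}
  refine ⟨fun y => treePoint (Tr y), ?_, fun y => ?_,
    fun y => deltaZero_mem_limitMeasures_treePoint _⟩
  · exact continuous_treePoint fun v =>
      isClopen_setOf_initSeg_mem he v.length {u | (u, v) ∈ S}
  · have hbranch : ∀ α : ℕ → ℕ, (∀ k, initSeg α k ∈ Tr y) ↔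
        ∀ k, (initSeg (e y) k, initSeg α k) ∈ S := by
      intro α
      simp [Tr]
    rw [hSB]
    constructor
    · intro h
      have htake : ∀ v ∈ Tr y, ∀ k, v.take k ∈ Tr y := fun v hv k => by
        simpa [Tr, take_initSeg] using hS _ _ hv k
      obtain ⟨α, hα⟩ := exists_branch_of_tightNonzero htake h
      exact ⟨α, (hbranch α).1 hα⟩
    · rintro ⟨α, hα⟩
      exact tightNonzero_treePoint ((hbranch α).2 hα)

lemma isSigmaOneOneComplete_hitG :
    IsSigmaOneOneComplete (hitG shift (invariantMeasures shift \ {deltaZero})) := by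
  rw [hitG_eq_setOf_tightNonzero]
  refine ⟨analyticSet_setOf_tightNonzero, fun Y _ _ hY B hB => ?_⟩
  obtain ⟨f, hf, hfB, -⟩ := exists_reduction hY hB
  exact ⟨f, hf, Set.ext hfB⟩

lemma isPiOneOneComplete_lowerG : IsPiOneOneComplete (lowerG shift {deltaZero}) := by
  rw [lowerG_eq_setOf_not_tightNonzero]
  refine ⟨?_, fun Y _ _ hY B hB => ?_⟩
  · simpa [CoanalyticSet, Set.compl_ofPred] using analyticSet_setOf_tightNonzero
  · obtain ⟨f, hf, hfB, -⟩ := exists_reduction hY hB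
    refine ⟨f, hf, Set.ext fun y => ?_⟩
    simp [hfB]

/-- `upperG` is Borel, so intersecting with it preserves coanalyticity; the reduction to `lowerG`
already takes values in `upperG`. -/
lemma isPiOneOneComplete_genericG : IsPiOneOneComplete (genericG shift {deltaZero}) := by
  refine ⟨?_, fun Y _ _ hY B hB => ?_⟩
  · rw [CoanalyticSet, genericG, Set.compl_inter, Set.union_eq_iUnion]
    refine AnalyticSet.iUnion fun b => ?_
    cases b
    · exact isPiOneOneComplete_lowerG.1
    · exact measurableSet_upperG.compl.analyticSet
  · obtain ⟨f, hf, hfB, hf0⟩ := exists_reduction hY hB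
    refine ⟨f, hf, Set.ext fun y => ?_⟩
    have hup : f y ∈ upperG shift {deltaZero} := Set.singleton_subset_iff.2 (hf0 y)
    simp [genericG, hup, lowerG_eq_setOf_not_tightNonzero, hfB]

lemma not_measurableSet_of_not_analyticSet {A : Set (ℕ → ℕ)} (hA : ¬ AnalyticSet A) :
    ¬ MeasurableSet[borel (ℕ → ℕ)] A := by
  intro h
  rw [← BorelSpace.measurable_eq (α := ℕ → ℕ)] at h
  exact hA h.analyticSet

/-! ### Specification -/

lemma exists_concatenation {k : ℕ} (x : Fin k → ℕ → ℕ) (l : Fin k → ℕ) :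
    ∃ y : ℕ → ℕ, ∀ j : Fin k, ∀ t < l j, y ((∑ i ∈ Finset.Iio j, l i) + t) = x j t := by
  classical
  have hmono : ∀ j j' : Fin k, j < j' →
      (∑ i ∈ Finset.Iio j, l i) + l j ≤ ∑ i ∈ Finset.Iio j', l i := by
    intro j j' hjj
    rw [add_comm, ← Finset.sum_insert (Finset.notMem_Iio_self)]
    refine Finset.sum_le_sum_of_subset fun i hi => ?_
    simp only [Finset.mem_insert, Finset.mem_Iio] at hi ⊢
    rcases hi with rfl | hi
    · exact hjj
    · exact hi.trans hjj
  let P : ℕ → Fin k → Prop := fun p j =>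
    ∑ i ∈ Finset.Iio j, l i ≤ p ∧ p < (∑ i ∈ Finset.Iio j, l i) + l j
  have huniq : ∀ p j j', P p j → P p j' → j = j' := by
    intro p j j' h h'
    rcases lt_trichotomy j j' with hlt | heq | hlt
    · have := hmono j j' hlt
      exact absurd h.2 (by have := h'.1; omega)
    · exact heq
    · have := hmono j' j hlt
      exact absurd h'.2 (by have := h.1; omega)
  refine ⟨fun p => if h : ∃ j, P p j then x h.choose (p - ∑ i ∈ Finset.Iio h.choose, l i) else 0,
    fun j t ht => ?_⟩
  have hP : P ((∑ i ∈ Finset.Iio j, l i) + t) j := ⟨by omega, by omega⟩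
  have h : ∃ j', P ((∑ i ∈ Finset.Iio j, l i) + t) j' := ⟨j, hP⟩
  simp only [dif_pos h]
  rw [huniq _ _ _ h.choose_spec hP, Nat.add_sub_cancel_left]

lemma specificationProperty_shift : @SpecificationProperty (ℕ → ℕ) baireMetric shift := by
  intro ε hε
  obtain ⟨m, hm⟩ := exists_pow_lt_of_lt_one hε (show (1 / 2 : ℝ) < 1 by norm_num)
  refine ⟨m, fun k _ x n _ => ?_⟩
  -- Closeness `2 ^ (-m)` at time `t < n j` concerns coordinates below `n j + m`, so each gap of
  -- length `m` continues the preceding segment.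
  obtain ⟨y, hy⟩ := exists_concatenation x fun j => n j + m
  refine ⟨y, fun _ => m, fun _ => le_rfl, fun j t ht => ?_⟩
  refine lt_of_le_of_lt ?_ hm
  refine PiNat.mem_cylinder_iff_dist_le.1 (PiNat.mem_cylinder_iff.2 fun i hi => ?_)
  rw [iterate_shift_apply, iterate_shift_apply, ← hy j (i + t) (by omega)]
  congr 1
  ring

end NonCompactGeneric

open NonCompactGeneric in
theorem mainTheorem3 :
    -- `(ω^ω, shift)` with the usual metric is a Polish dynamical system with specification
    PolishSpace (ℕ → ℕ) ∧ Continuous shift ∧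
    baireMetric.toUniformSpace.toTopologicalSpace = Pi.topologicalSpace ∧
    @CompleteSpace (ℕ → ℕ) baireMetric.toUniformSpace ∧
    @SpecificationProperty (ℕ → ℕ) baireMetric shift ∧
    -- `V = {δ}` is a closed connected nonempty set of invariant measures
    {deltaZero} ⊆ invariantMeasures shift ∧
    IsClosed ({deltaZero} : Set (ProbabilityMeasure (ℕ → ℕ))) ∧
    IsConnected ({deltaZero} : Set (ProbabilityMeasure (ℕ → ℕ))) ∧
    -- `G(V)` and `G_V` are complete coanalytic; hence not analytic, and not Borel
    IsPiOneOneComplete (genericG shift {deltaZero}) ∧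
    ¬ AnalyticSet (genericG shift {deltaZero}) ∧
    ¬ MeasurableSet[borel (ℕ → ℕ)] (genericG shift {deltaZero}) ∧
    IsPiOneOneComplete (lowerG shift {deltaZero}) ∧
    ¬ AnalyticSet (lowerG shift {deltaZero}) ∧
    ¬ MeasurableSet[borel (ℕ → ℕ)] (lowerG shift {deltaZero}) ∧
    -- `^U G` is complete analytic for `U = M_T \ {δ}`; hence not coanalytic, and not Borel
    IsSigmaOneOneComplete (hitG shift (invariantMeasures shift \ {deltaZero})) ∧
    ¬ CoanalyticSet (hitG shift (invariantMeasures shift \ {deltaZero})) ∧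
    ¬ MeasurableSet[borel (ℕ → ℕ)]
      (hitG shift (invariantMeasures shift \ {deltaZero})) := by
  refine ⟨inferInstance, continuous_shift, rfl, ?_, specificationProperty_shift,
    Set.singleton_subset_iff.2 deltaZero_mem_invariantMeasures, isClosed_singleton,
    isConnected_singleton, isPiOneOneComplete_genericG,
    isPiOneOneComplete_genericG.not_analyticSet,
    not_measurableSet_of_not_analyticSet isPiOneOneComplete_genericG.not_analyticSet,
    isPiOneOneComplete_lowerG, isPiOneOneComplete_lowerG.not_analyticSet,
    not_measurableSet_of_not_analyticSet isPiOneOneComplete_lowerG.not_analyticSet,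
    isSigmaOneOneComplete_hitG, isSigmaOneOneComplete_hitG.not_coanalyticSet, fun h => ?_⟩
  · exact Pi.complete _
  · rw [← BorelSpace.measurable_eq (α := ℕ → ℕ)] at h
    exact isSigmaOneOneComplete_hitG.not_coanalyticSet h.compl.analyticSet
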